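/- Let $b\in\mathbb{Q}\setminus\mathbb{Z}$ with $b\le 0$, and let $S=b+\mathbb{Z}_+=\{b+k : k\in\mathbb{Z},\ k\ge 0\}$. A function $\pi\colon\mathbb{R}\to\mathbb{R}$ is a cut-generating function (CGF) for $S$ if $\sum_{i=1}^k \pi(r_i)y_i\ge 1$ for every $k\in\mathbb{N}$, all $r_1,\dots,r_k\in\mathbb{R}$ and all nonnegative integers $y_1,\dots,y_k$ with $\sum_{i=1}^k r_iy_i\in S$. A CGF $\pi$ for $S$ is strongly minimal if there are no CGF $\pi'\neq\pi$ for $S$, real $\beta\ge 0$ and reals $\alpha,\alpha_0$ such that $\alpha s\ge\alpha_0$ for all $s\in S$, $\beta\pi'(r)+\alpha r\le\pi(r)$ for all $r\in\mathbb{R}$, and $\beta+\alpha_0\ge 1$. A CGF $\pi$ for $S$ is extreme if there are no two distinct CGFs $\pi_1,\pi_2$ for $S$, both bounded below on every bounded interval, with $\pi=\frac{\pi_1+\pi_2}{2}$. A function $\phi\colon\mathbb{R}\to\mathbb{R}$ is piecewise linear if $\mathbb{R}$ is covered by a family of closed nondegenerate intervals, only finitely many of which meet any given bounded set, such that $\phi$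 is affine on each of them; it is a 2-slope function if moreover its slope takes exactly two values. Let $\bar\pi\colon\mathbb{R}\to\mathbb{R}$ be a continuous strongly minimal function for $S$ that is quasi-periodic with rational period, i.e. there are a rational $d>0$ and a real $c$ with $\bar\pi(r+d)=\bar\pi(r)+c$ for all $r\in\mathbb{R}$. Then for every real $M\ge 0$ and every $\epsilon>0$ there is an extreme 2-slope function $\pi^*$ for $S$ such that $|\bar\pi(r)-\pi^*(r)|\le\epsilon$ for all $r\in[-M,M]$. -/

import Mathlib

/-- `IsCGF S π`: `π` is a cut-generating function for `S ⊆ ℝ`, i.e. for all finitely many reals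
`r₁, …, r_k` the inequality `∑ π(rᵢ) yᵢ ≥ 1` holds for all nonnegative integers `y₁, …, y_k`
with `∑ rᵢ yᵢ ∈ S`. -/
def IsCGF (S : Set ℝ) (π : ℝ → ℝ) : Prop :=
  ∀ (k : ℕ) (r : Fin k → ℝ) (y : Fin k → ℕ),
    (∑ i, r i * (y i : ℝ)) ∈ S → 1 ≤ ∑ i, π (r i) * (y i : ℝ)

/-- The inequality `α x ≥ α₀` is valid for `S`. -/
def IsValidIneq (S : Set ℝ) (α α₀ : ℝ) : Prop :=
  ∀ s ∈ S, α₀ ≤ α * s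

/-- `π` is a strongly minimal cut-generating function for `S`. -/
def IsStronglyMinimal (S : Set ℝ) (π : ℝ → ℝ) : Prop :=
  IsCGF S π ∧
    ¬ ∃ (π' : ℝ → ℝ) (β α α₀ : ℝ), IsCGF S π' ∧ π' ≠ π ∧ 0 ≤ β ∧ IsValidIneq S α α₀ ∧
      (∀ r : ℝ, β * π' r + α * r ≤ π r) ∧ 1 ≤ β + α₀

/-- `π` is bounded below on every bounded interval. -/
def LocallyBddBelow (π : ℝ → ℝ) : Prop :=
  ∀ a b : ℝ, BddBelow (π '' Set.Icc a b)

/-- `π` is an extreme cut-generating function for `S`: it is not the average of two distinct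
cut-generating functions.

The two functions range over the cut-generating functions that are bounded below on bounded
intervals (in particular over all continuous and over all nonnegative ones). Some such condition
is needed: if `h : ℝ → ℝ` is additive, nonzero, and zero on the rationals, and `S` consists of
rationals, then `π + h` and `π - h` are cut-generating functions whenever `π` is one. -/
def IsExtremeCGF (S : Set ℝ) (π : ℝ → ℝ) : Prop :=
  IsCGF S π ∧
    ¬ ∃ π₁ π₂ : ℝ → ℝ, IsCGF S π₁ ∧ IsCGF S π₂ ∧ LocallyBddBelow π₁ ∧ LocallyBddBelow π₂ ∧
      π₁ ≠ π₂ ∧ ∀ r : ℝ, π r = (π₁ r + π₂ r) / 2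

/-- `φ` is affine with slope `m` on the set `I`. -/
def IsAffineOnWithSlope (φ : ℝ → ℝ) (I : Set ℝ) (m : ℝ) : Prop :=
  ∃ c : ℝ, ∀ x ∈ I, φ x = m * x + c

/-- `φ` is piecewise linear: the line is covered by a family of closed nondegenerate (possibly
unbounded) intervals, only finitely many of which meet any given bounded set, and `φ` is affine on
each of them. -/
def IsPiecewiseLinear (φ : ℝ → ℝ) : Prop :=
  ∃ J : Set (Set ℝ),
    (∀ I ∈ J, IsClosed I ∧ I.OrdConnected ∧ I.Nontrivial) ∧
    ⋃₀ J = Set.univ ∧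
    (∀ B : Set ℝ, Bornology.IsBounded B → {I ∈ J | (I ∩ B).Nonempty}.Finite) ∧
    ∀ I ∈ J, ∃ m : ℝ, IsAffineOnWithSlope φ I m

/-- The slopes of `φ`: all slopes that `φ` takes on some nondegenerate interval. -/
def slopes (φ : ℝ → ℝ) : Set ℝ :=
  {m | ∃ x y : ℝ, x < y ∧ IsAffineOnWithSlope φ (Set.Icc x y) m}

/-- `φ` is a 2-slope function: piecewise linear with exactly two values of the slope. -/
def IsTwoSlope (φ : ℝ → ℝ) : Prop :=
  IsPiecewiseLinear φ ∧ (slopes φ).encard = 2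

/-- `φ` is quasi-periodic with period `d`. -/
def IsQuasiPeriodic (φ : ℝ → ℝ) (d : ℝ) : Prop :=
  0 < d ∧ ∃ c : ℝ, ∀ r : ℝ, φ (r + d) = φ r + c

/-- The truncated affine lattice `b + ℤ₊`. -/
def truncatedAffineLattice (b : ℝ) : Set ℝ :=
  {x | ∃ k : ℕ, x = b + k}

/-! A strongly minimal function for `b + ℤ₊` with rational `b < 0` vanishes at `0` and `-1`, is
subadditive and satisfies `π x + π (b - x) = 1`. Conversely these properties, collected in
`IsSymmSubadditive`, make any function a CGF, so the approximation can be carried out entirely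
inside this convex class.

Rounding a function to two slopes destroys subadditivity wherever it is tight, so slack is created
first. A convex combination with a small multiple of `strictSymm b`, which is discontinuous but
strictly subadditive whenever `x ≠ 0`, `y ≠ 0` and `x + y ≠ b`, is interpolated linearly on a fine
grid `(1/q)ℤ` containing `b` and `-1`. The interpolant stays close to `πbar` on the window, and has
uniform slack away from strips around the lines `x = 0`, `y = 0`, `x + y = b`
(`exists_extreme_near_interp`).

Subadditivity forces the slopes of the interpolant beside `0` to be its largest slope `p` (right)
and its smallest slope `n` (left). A symmetric zigzag with only these slopes, equal to the
interpolant on the grid, is then subadditive: the slack absorbs the error off the strips, while in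
the strips extremality of `p` and `n`, together with symmetry, suffices (`exists_extreme_near`).
Finally, a symmetric subadditive function with two slopes, both realised at `0`, is extreme
(`eq_of_average_of_hasRightSlopes`). -/

/-! ### Cut-generating functions through multisets, and the symmetric subadditive class -/

theorem isCGF_iff_multiset {S : Set ℝ} {π : ℝ → ℝ} :
    IsCGF S π ↔ ∀ L : Multiset ℝ, L.sum ∈ S → 1 ≤ (L.map π).sum := by
  constructor
  · intro h L
    induction L using Quotient.inductionOn with
    | h l =>
      intro hl
      have := h l.length (fun i => l[i.1]) (fun _ => 1)
      have e1 := Fin.sum_univ_fun_getElem l (fun x : ℝ => x)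
      have e2 := Fin.sum_univ_fun_getElem l π
      simp only [Nat.cast_one, mul_one] at this
      rw [e1, e2] at this
      simpa using this (by simpa using hl)
  · intro h k r y hs
    have e (f : ℝ → ℝ) : ((∑ i, y i • ({r i} : Multiset ℝ)).map f).sum
        = ∑ i, f (r i) * (y i : ℝ) := by
      have := map_sum (Multiset.sumAddMonoidHom.comp (Multiset.mapAddMonoidHom f))
        (fun i => y i • ({r i} : Multiset ℝ)) Finset.univ
      simp only [AddMonoidHom.comp_apply, Multiset.coe_mapAddMonoidHom,
        Multiset.coe_sumAddMonoidHom] at this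
      rw [this]
      refine Finset.sum_congr rfl fun i _ => ?_
      rw [Multiset.map_nsmul, Multiset.sum_nsmul]
      simp [mul_comm]
    have h1 := h (∑ i, y i • ({r i} : Multiset ℝ))
    have e1 := e id
    rw [Multiset.map_id] at e1
    rw [e π, e1] at h1
    exact h1 hs

theorem IsCGF.substitute {S : Set ℝ} {π π' : ℝ → ℝ} (hπ : IsCGF S π) (T : ℝ → Multiset ℝ)
    (hS : ∀ L : Multiset ℝ, L.sum ∈ S → (L.map fun r => (T r).sum).sum ∈ S)
    (hT : ∀ r, ((T r).map π).sum ≤ π' r) : IsCGF S π' := by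
  rw [isCGF_iff_multiset] at hπ ⊢
  intro L hL
  have h := hπ (L.bind T) (by rw [Multiset.sum_bind]; exact hS L hL)
  rw [Multiset.map_bind, Multiset.sum_bind] at h
  exact h.trans (Multiset.sum_map_le_sum_map _ _ fun r _ => hT r)

/-- Normalized subadditive functions that are symmetric about `b / 2`. -/
structure IsSymmSubadditive (b : ℝ) (π : ℝ → ℝ) : Prop where
  zero : π 0 = 0
  neg_one : π (-1) = 0
  add_le : ∀ x y, π (x + y) ≤ π x + π y
  symm : ∀ x, π x + π (b - x) = 1

theorem subadditive_nsmul_le {π : ℝ → ℝ} (h0 : π 0 = 0)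
    (hadd : ∀ x y, π (x + y) ≤ π x + π y) (n : ℕ) (x : ℝ) : π (n * x) ≤ n * π x := by
  induction n with
  | zero => simp [h0]
  | succ n ih =>
    have := hadd (n * x) x
    push_cast
    rw [add_mul, one_mul]
    linarith

theorem subadditive_multiset_sum_le {π : ℝ → ℝ} (h0 : π 0 = 0)
    (hadd : ∀ x y, π (x + y) ≤ π x + π y) (L : Multiset ℝ) : π L.sum ≤ (L.map π).sum := by
  induction L using Multiset.induction with
  | empty => simp [h0]
  | cons a L ih =>
    have := hadd a L.sum
    simp only [Multiset.sum_cons, Multiset.map_cons]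
    linarith

/-- Copies of `-1` cost nothing and bring a sum `b + k` down to `b`, where symmetry at `0` gives `π
b = 1`. -/
theorem IsSymmSubadditive.isCGF {b : ℝ} {π : ℝ → ℝ} (h : IsSymmSubadditive b π) :
    IsCGF (truncatedAffineLattice b) π := by
  rw [isCGF_iff_multiset]
  rintro L ⟨k, hk⟩
  have h1 := subadditive_multiset_sum_le h.zero h.add_le L
  have h2 := h.add_le L.sum (k * (-1))
  have h3 := subadditive_nsmul_le h.zero h.add_le k (-1)
  have h4 := h.symm 0
  rw [h.zero, sub_zero] at h4
  rw [h.neg_one] at h3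
  have : L.sum + k * (-1) = b := by rw [hk]; ring
  rw [this] at h2
  linarith

/-! ### Strongly minimal functions are subadditive and symmetric -/

theorem mem_truncatedAffineLattice_self (b : ℝ) : b ∈ truncatedAffineLattice b := ⟨0, by simp⟩

theorem IsStronglyMinimal.eq_of_le {S : Set ℝ} {π π' : ℝ → ℝ} (h : IsStronglyMinimal S π)
    (hπ' : IsCGF S π') (hle : ∀ r, π' r ≤ π r) : π' = π := by
  by_contra hne
  exact h.2 ⟨π', 1, 0, 0, hπ', hne, zero_le_one, fun s _ => by simp, fun r => by simpa using hle r,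
    by simp⟩

theorem IsCGF.nonneg_zero {b : ℝ} {π : ℝ → ℝ} (h : IsCGF (truncatedAffineLattice b) π) :
    0 ≤ π 0 := by
  rw [isCGF_iff_multiset] at h
  by_contra! hneg
  obtain ⟨n, hn⟩ := exists_nat_gt ((π b - 1) / (-π 0))
  rw [div_lt_iff₀ (by linarith)] at hn
  have := h (b ::ₘ Multiset.replicate n 0) (by simpa using mem_truncatedAffineLattice_self b)
  simp at this
  linarith

theorem IsStronglyMinimal.zero {b : ℝ} {π : ℝ → ℝ}
    (h : IsStronglyMinimal (truncatedAffineLattice b) π) : π 0 = 0 := by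
  have h0 := h.1.nonneg_zero
  have hc : IsCGF (truncatedAffineLattice b) (Function.update π 0 0) := by
    refine h.1.substitute (fun r => if r = 0 then 0 else {r}) (fun L hL => ?_) fun r => ?_
    · have : (fun r : ℝ => (if r = 0 then 0 else {r} : Multiset ℝ).sum) = fun r => r := by
        ext r; split_ifs with hr <;> simp [hr]
      rw [this]; simpa using hL
    · by_cases hr : r = 0 <;> simp [hr]
  have := congrFun (h.eq_of_le hc fun r => by
    by_cases hr : r = 0
    · subst hr; simpa using h0
    · simp [hr]) 0
  simpa using this.symm

theorem IsStronglyMinimal.neg_one_nonpos {b : ℝ} {π : ℝ → ℝ}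
    (h : IsStronglyMinimal (truncatedAffineLattice b) π) : π (-1) ≤ 0 := by
  by_contra! hpos
  have hc : IsCGF (truncatedAffineLattice b) (Function.update π (-1) 0) := by
    refine h.1.substitute (fun r => if r = -1 then 0 else {r}) (fun L hL => ?_) fun r => ?_
    · have : ∃ n : ℕ, (L.map fun r : ℝ => (if r = -1 then 0 else {r} : Multiset ℝ).sum).sum
          = L.sum + n := by
        clear hL
        induction L using Multiset.induction with
        | empty => exact ⟨0, by simp⟩
        | cons a L ih =>
          obtain ⟨n, hn⟩ := ih
          by_cases ha : a = -1
          · exact ⟨n + 1, by simp [hn, ha]; ring⟩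
          · exact ⟨n, by simp [hn, ha, add_assoc]⟩
      obtain ⟨n, hn⟩ := this
      obtain ⟨k, hk⟩ := hL
      exact ⟨k + n, by rw [hn, hk]; push_cast; ring⟩
    · by_cases hr : r = -1 <;> simp [hr]
  have := congrFun (h.eq_of_le hc fun r => by
    by_cases hr : r = -1
    · subst hr; simpa using hpos.le
    · simp [hr]) (-1)
  simp at this
  linarith

/-- If `π (-1) = -a < 0`, then padding a family of sum `b + k` with `k` copies of `-1` improves its
inequality by `a * k`. Hence `π` minus the linear term `a * r`, rescaled, is still a CGF, and `π` is
implied by it and the valid inequality `a * s ≥ a * b`. -/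
theorem IsStronglyMinimal.neg_one {b : ℝ} (hb : b < 0) {π : ℝ → ℝ}
    (h : IsStronglyMinimal (truncatedAffineLattice b) π) : π (-1) = 0 := by
  refine le_antisymm h.neg_one_nonpos ?_
  by_contra! hneg
  set a := -π (-1) with ha
  have ha0 : 0 < a := by linarith
  have hβ : 0 < 1 - a * b := by nlinarith
  refine h.2 ⟨fun r => (π r - a * r) / (1 - a * b), 1 - a * b, a, a * b, ?_, ?_, hβ.le, ?_, ?_, ?_⟩
  · have hC := h.1
    rw [isCGF_iff_multiset] at hC ⊢
    rintro L ⟨k, hk⟩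
    have h1 := hC (L + Multiset.replicate k (-1)) ⟨0, by simp [hk]⟩
    have h2 : (L.map fun r => (π r - a * r) / (1 - a * b)).sum
        = ((L.map π).sum - a * L.sum) / (1 - a * b) := by
      rw [Multiset.sum_map_div, Multiset.sum_map_sub, Multiset.sum_map_mul_left, Multiset.map_id']
    rw [h2, le_div_iff₀ hβ, hk]
    simp at h1
    rw [ha]
    linarith
  · intro he
    have h1 := congrFun he (-1)
    rw [div_eq_iff hβ.ne'] at h1
    nlinarith [mul_pos ha0 ha0]
  · rintro s ⟨k, rfl⟩
    have : (0 : ℝ) ≤ a * k := by positivity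
    linarith
  · intro r
    rw [mul_div_cancel₀ _ hβ.ne']
    linarith
  · linarith

theorem IsStronglyMinimal.add_le {S : Set ℝ} {π : ℝ → ℝ} (h : IsStronglyMinimal S π) (x y : ℝ) :
    π (x + y) ≤ π x + π y := by
  by_contra! hlt
  have hc : IsCGF S (Function.update π (x + y) (π x + π y)) := by
    refine h.1.substitute (fun r => if r = x + y then {x, y} else {r}) (fun L hL => ?_) fun r => ?_
    · have : (fun r : ℝ => (if r = x + y then {x, y} else {r} : Multiset ℝ).sum) = fun r => r := by
        ext r; split_ifs with hr <;> simp [hr]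
      rw [this]; simpa using hL
    · by_cases hr : r = x + y <;> simp [hr]
  have := congrFun (h.eq_of_le hc fun r => by
    by_cases hr : r = x + y
    · subst hr; simpa using hlt.le
    · simp [hr]) (x + y)
  simp at this
  linarith

theorem multiset_sum_map_update {π : ℝ → ℝ} (h0 : π 0 = 0)
    (hadd : ∀ x y, π (x + y) ≤ π x + π y) (r v : ℝ) (L : Multiset ℝ) :
    ∃ k : ℕ, k * v + π (L.sum - k * r) ≤ (L.map (Function.update π r v)).sum := by
  induction L using Multiset.induction with
  | empty => exact ⟨0, by simp [h0]⟩
  | cons a L ih =>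
    obtain ⟨k, hk⟩ := ih
    by_cases ha : a = r
    · refine ⟨k + 1, ?_⟩
      subst ha
      have : a + L.sum - (k + 1) * a = L.sum - k * a := by ring
      simp [this]
      linarith
    · refine ⟨k, ?_⟩
      have h1 := hadd a (L.sum - k * r)
      have : a + L.sum - k * r = a + (L.sum - k * r) := by ring
      simp [ha, this]
      linarith

/-- Minimality forbids lowering `π r` even slightly, so some family violates the lowered inequality.
A tiny decrease can only matter if the family uses `r` many times, and then `π (k * (-r))` is very
negative. -/
theorem IsStronglyMinimal.exists_lt_of_symm_lt {b : ℝ} (hb : b < 0) {π : ℝ → ℝ}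
    (h : IsStronglyMinimal (truncatedAffineLattice b) π) {r : ℝ} (hr : 1 < π r + π (b - r)) :
    ∃ k : ℕ, 0 < k ∧ π (k * (-r)) ≤ -k * (π r - 1 / 4) := by
  have h0 := h.zero
  have h1 := h.neg_one hb
  have hadd := h.add_le
  set e := π r + π (b - r) - 1 with he
  have he0 : 0 < e := by linarith
  obtain ⟨K, hK⟩ := exists_nat_gt (8 * (1 + π (-b)))
  -- The second bound forces more than `K + 1` copies of `r`; the choice of `K` and `t ≤ 1 / 8` then
  -- make both error terms at most `k / 8`.
  set t := min (1 / 8) (e / (K + 1)) with ht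
  have hK1 : (0 : ℝ) < K + 1 := by positivity
  have ht0 : 0 < t := lt_min (by norm_num) (by positivity)
  have ht8 : t ≤ 1 / 8 := min_le_left _ _
  have htK : t * (K + 1) ≤ e := by
    rw [← le_div_iff₀ hK1]; exact min_le_right _ _
  have hnot : ¬ IsCGF (truncatedAffineLattice b) (Function.update π r (π r - t)) := by
    intro hc
    have := congrFun (h.eq_of_le hc fun x => by
      by_cases hx : x = r
      · subst hx; simp [ht0.le]
      · simp [hx]) r
    simp at this
    linarith
  rw [isCGF_iff_multiset] at hnot
  push Not at hnot
  obtain ⟨L, ⟨z, hz⟩, hL⟩ := hnot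
  obtain ⟨k, hk⟩ := multiset_sum_map_update h0 hadd r (π r - t) L
  have hz1 := hadd (L.sum - k * r) (z * (-1))
  have hz2 := subadditive_nsmul_le h0 hadd z (-1)
  rw [h1, mul_zero] at hz2
  have hz3 : L.sum - k * r + z * (-1) = b - k * r := by rw [hz]; ring
  rw [hz3] at hz1
  have hmain : k * (π r - t) + π (b - k * r) < 1 := by linarith
  have hk0 : 0 < k := by
    rcases Nat.eq_zero_or_pos k with hk0 | hk0
    · subst hk0
      have hb1 := (isCGF_iff_multiset.1 h.1) {b} (by simpa using mem_truncatedAffineLattice_self b)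
      simp at hmain hb1
      linarith
    · exact hk0
  obtain ⟨j, rfl⟩ : ∃ j, k = j + 1 := ⟨k - 1, by omega⟩
  have h2 := hadd (b - (j + 1 : ℕ) * r) (j * r)
  have h3 := subadditive_nsmul_le h0 hadd j r
  have h4 : b - (j + 1 : ℕ) * r + j * r = b - r := by push_cast; ring
  rw [h4] at h2
  -- Adding back all but one copy of `r` leads from `b - k * r` to `b - r`, so the total decrease `k
  -- * t` must exceed the symmetry defect.
  have h5 : e < (j + 1 : ℕ) * t := by
    push_cast at *
    nlinarith
  have h6 : (K : ℝ) + 1 < (j + 1 : ℕ) := by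
    by_contra! hcon
    nlinarith
  have h7 := hadd (b - (j + 1 : ℕ) * r) (-b)
  have h8 : b - (j + 1 : ℕ) * r + -b = (j + 1 : ℕ) * (-r) := by ring
  rw [h8] at h7
  refine ⟨j + 1, hk0, ?_⟩
  nlinarith

/-- If symmetry fails at `r`, it fails at `b - r` too. Multiples of the two resulting very negative
points add up to a multiple of `-b`; since `b` is rational, this can be made an integer and
cancelled by free copies of `-1`, giving `π 0 < 0`. -/
theorem IsStronglyMinimal.isSymmSubadditive {b : ℚ} (hb : b < 0) {π : ℝ → ℝ}
    (h : IsStronglyMinimal (truncatedAffineLattice (b : ℝ)) π) : IsSymmSubadditive (b : ℝ) π := by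
  have hb' : (b : ℝ) < 0 := by exact_mod_cast hb
  have h0 := h.zero
  have hadd := h.add_le
  refine ⟨h0, h.neg_one hb', hadd, fun r => ?_⟩
  have hge : 1 ≤ π r + π (b - r) := by
    have := (isCGF_iff_multiset.1 h.1) {r, b - r} (by
      simpa using mem_truncatedAffineLattice_self (b : ℝ))
    simpa using this
  by_contra hne
  have hlt : 1 < π r + π (b - r) := lt_of_le_of_ne hge (Ne.symm hne)
  obtain ⟨k₀, hk₀, h₀⟩ := h.exists_lt_of_symm_lt hb' hlt
  obtain ⟨k₁, hk₁, h₁⟩ := h.exists_lt_of_symm_lt (r := b - r) hb' (by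
    rw [sub_sub_cancel]; linarith)
  obtain ⟨m, hm⟩ : ∃ m : ℕ, (b.den : ℝ) * b = m * (-1) := by
    refine ⟨b.num.natAbs, ?_⟩
    have h1 : (b.den : ℝ) * b = (b.num : ℝ) := by
      have := Rat.den_mul_eq_num b
      exact_mod_cast this
    have h2 : (b.num.natAbs : ℤ) = -b.num := by
      have := Rat.num_neg.2 hb
      omega
    have h3 : (b.num.natAbs : ℝ) = -(b.num : ℝ) := by
      rw [← Int.cast_neg, ← h2, Int.cast_natCast]
    rw [h1, h3]; ring
  have hd : (0 : ℝ) < b.den := by exact_mod_cast b.den_pos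
  have hk₀' : (0 : ℝ) < k₀ := by exact_mod_cast hk₀
  have hk₁' : (0 : ℝ) < k₁ := by exact_mod_cast hk₁
  have a₀ := subadditive_nsmul_le h0 hadd (k₁ * b.den) (k₀ * (-r))
  have a₁ := subadditive_nsmul_le h0 hadd (k₀ * b.den) (k₁ * (-(b - r)))
  have a₂ := subadditive_nsmul_le h0 hadd (k₀ * k₁ * m) (-1)
  rw [h.neg_one hb', mul_zero] at a₂
  have b₀ := hadd ((k₁ * b.den : ℕ) * (k₀ * (-r))) ((k₀ * b.den : ℕ) * (k₁ * (-(b - r))))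
  have b₁ := hadd ((k₁ * b.den : ℕ) * (k₀ * (-r)) + (k₀ * b.den : ℕ) * (k₁ * (-(b - r))))
    ((k₀ * k₁ * m : ℕ) * (-1))
  have e : ((k₁ * b.den : ℕ) * (k₀ * (-r)) + (k₀ * b.den : ℕ) * (k₁ * (-(b - r))))
    + ((k₀ * k₁ * m : ℕ) * (-1) : ℝ) = 0 := by
    push_cast
    linear_combination (-(k₀ * k₁ : ℝ)) * hm
  rw [e, h0] at b₁
  have c₀ : ((k₁ * b.den : ℕ) : ℝ) * π (k₀ * (-r)) ≤ (k₁ * b.den : ℕ) * (-k₀ * (π r - 1 / 4)) :=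
    mul_le_mul_of_nonneg_left h₀ (by positivity)
  have c₁ : ((k₀ * b.den : ℕ) : ℝ) * π (k₁ * (-(b - r)))
      ≤ (k₀ * b.den : ℕ) * (-k₁ * (π (b - r) - 1 / 4)) :=
    mul_le_mul_of_nonneg_left h₁ (by positivity)
  push_cast at *
  have hpos : (0 : ℝ) < k₀ * k₁ * b.den := by positivity
  nlinarith

/-! ### Extremality of symmetric subadditive functions with two slopes -/

/-- After subtracting the chord, the remainder vanishes at `δ`. It doubles under `t ↦ 2 * t` modulo
`δ`, so every bound for it can be halved indefinitely. -/
theorem eq_mul_of_additive_of_bounded {g : ℝ → ℝ} {δ C : ℝ} (hδ : 0 < δ)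
    (hadd : ∀ s t, 0 ≤ s → 0 ≤ t → s + t ≤ δ → g (s + t) = g s + g t)
    (hC : ∀ t, 0 ≤ t → t ≤ δ → |g t| ≤ C) :
    ∀ t, 0 ≤ t → t ≤ δ → g t = g δ / δ * t := by
  set k : ℝ → ℝ := fun t => g t - g δ / δ * t with hk
  have kadd : ∀ s t, 0 ≤ s → 0 ≤ t → s + t ≤ δ → k (s + t) = k s + k t := by
    intro s t hs ht hst
    simp only [hk]
    rw [hadd s t hs ht hst]; ring
  have kδ : k δ = 0 := by
    simp only [hk]
    field_simp
    ring
  have step : ∀ D : ℝ, (∀ t, 0 ≤ t → t ≤ δ → |k t| ≤ D) → ∀ t, 0 ≤ t → t ≤ δ → |k t| ≤ D / 2 := by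
    intro D hD t ht0 htδ
    rcases le_total (2 * t) δ with h | h
    · have h1 := kadd t t ht0 ht0 (by linarith)
      have h2 := hD (t + t) (by linarith) (by linarith)
      rw [h1, ← two_mul, abs_mul, abs_two] at h2
      linarith
    · have h1 := kadd (2 * t - δ) (δ - t) (by linarith) (by linarith) (by linarith)
      have h3 := kadd t (δ - t) (by linarith) (by linarith) (by linarith)
      have h2 := hD (2 * t - δ) (by linarith) (by linarith)
      rw [add_sub_cancel, kδ] at h3
      have e : 2 * t - δ + (δ - t) = t := by ring
      rw [e] at h1
      have h4 : k (2 * t - δ) = 2 * k t := by linarith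
      rw [h4, abs_mul, abs_two] at h2
      linarith
  have h0 : ∀ t, 0 ≤ t → t ≤ δ → |k t| ≤ C + |g δ / δ| * δ := by
    intro t ht0 htδ
    have h1 := abs_sub (g t) (g δ / δ * t)
    have h2 : |g δ / δ * t| ≤ |g δ / δ| * δ := by
      rw [abs_mul, abs_of_nonneg ht0]
      exact mul_le_mul_of_nonneg_left htδ (abs_nonneg _)
    have h3 := hC t ht0 htδ
    calc |k t| ≤ |g t| + |g δ / δ * t| := h1
      _ ≤ _ := by linarith
  have hn : ∀ n : ℕ, ∀ t, 0 ≤ t → t ≤ δ → |k t| ≤ (C + |g δ / δ| * δ) * (1 / 2) ^ n := by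
    intro n
    induction n with
    | zero => simpa using h0
    | succ n ih =>
      intro t ht0 htδ
      have := step _ ih t ht0 htδ
      rw [pow_succ]
      linarith
  intro t ht0 htδ
  have hlim : Filter.Tendsto (fun n : ℕ => (C + |g δ / δ| * δ) * (1 / 2 : ℝ) ^ n) Filter.atTop
      (nhds ((C + |g δ / δ| * δ) * 0)) :=
    (tendsto_pow_atTop_nhds_zero_of_lt_one (by norm_num) (by norm_num)).const_mul _
  rw [mul_zero] at hlim
  have h1 : |k t| ≤ 0 := ge_of_tendsto' hlim fun n => hn n t ht0 htδ
  have h2 : k t = 0 := abs_nonpos_iff.1 h1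
  simp only [hk] at h2
  linarith

/-- Both summands satisfy the CGF inequality for `{r, b - r}`, and the average is tight there, so
both are tight. With symmetry, the CGF inequality for `{x, y, b - (x + y)}` is subadditivity. -/
theorem IsSymmSubadditive.of_average {b : ℝ} {π π₁ π₂ : ℝ → ℝ} (h : IsSymmSubadditive b π)
    (h₁ : IsCGF (truncatedAffineLattice b) π₁) (h₂ : IsCGF (truncatedAffineLattice b) π₂)
    (hav : ∀ r, π r = (π₁ r + π₂ r) / 2) : IsSymmSubadditive b π₁ := by
  have z₁ := h₁.nonneg_zero
  have z₂ := h₂.nonneg_zero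
  have c₁ := isCGF_iff_multiset.1 h₁
  have c₂ := isCGF_iff_multiset.1 h₂
  have p₁ (r : ℝ) : 1 ≤ π₁ r + π₁ (b - r) := by
    simpa using c₁ {r, b - r} (by simpa using mem_truncatedAffineLattice_self b)
  have p₂ (r : ℝ) : 1 ≤ π₂ r + π₂ (b - r) := by
    simpa using c₂ {r, b - r} (by simpa using mem_truncatedAffineLattice_self b)
  have s₁ (r : ℝ) : π₁ r + π₁ (b - r) = 1 := by
    linarith [p₁ r, p₂ r, h.symm r, hav r, hav (b - r)]
  have s₂ (r : ℝ) : π₂ r + π₂ (b - r) = 1 := by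
    linarith [p₁ r, p₂ r, h.symm r, hav r, hav (b - r)]
  refine ⟨by linarith [hav 0, h.zero], ?_, fun x y => ?_, s₁⟩
  · have n₁ : 1 ≤ π₁ (b + 1) := by simpa using c₁ {b + 1} ⟨1, by simp⟩
    have n₂ : 1 ≤ π₂ (b + 1) := by simpa using c₂ {b + 1} ⟨1, by simp⟩
    have e₁ := s₁ (-1)
    have e₂ := s₂ (-1)
    rw [sub_neg_eq_add] at e₁ e₂
    linarith [hav (-1), h.neg_one]
  · have t := c₁ {x, y, b - (x + y)} ⟨0, by simp; ring⟩
    simp at t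
    linarith [s₁ (x + y)]

theorem eq_of_forall_locally_const {f : ℝ → ℝ}
    (h : ∀ x, ∃ η > 0, ∀ t, 0 ≤ t → t ≤ η → f (x + t) = f x ∧ f (x - t) = f x) (x y : ℝ) :
    f x = f y := by
  have hl : IsLocallyConstant f := by
    rw [IsLocallyConstant.iff_eventually_eq]
    intro x
    obtain ⟨η, hη, hx⟩ := h x
    filter_upwards [Metric.ball_mem_nhds x hη] with y hy
    rw [Metric.mem_ball, Real.dist_eq, abs_lt] at hy
    rcases le_total x y with hxy | hxy
    · have := (hx (y - x) (by linarith) (by linarith)).1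
      rwa [add_sub_cancel] at this
    · have := (hx (x - y) (by linarith) (by linarith)).2
      rwa [sub_sub_cancel] at this
  exact hl.apply_eq_of_preconnectedSpace x y

/-- `π` continues to the right of every point with one of the slopes `p` and `n`. -/
def HasRightSlopes (π : ℝ → ℝ) (p n : ℝ) : Prop :=
  ∀ x, ∃ η > 0, (∀ t, 0 ≤ t → t ≤ η → π (x + t) = π x + p * t) ∨
    (∀ t, 0 ≤ t → t ≤ η → π (x + t) = π x + n * t)

/-- Additive relations of `π` pass to `π₁`, so `π₁` is linear on each side of `0`, and its two
slopes there determine its slope wherever `π` has slope `p` or `n`. Thus `π₁` is `A * π` plus a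
linear function; the values at `-1` and `b` fix the coefficients. -/
theorem eq_of_average_of_hasRightSlopes {b δ p n : ℝ} {π π₁ π₂ : ℝ → ℝ}
    (h : IsSymmSubadditive b π) (hδ : 0 < δ) (hpn : n < p)
    (hp : ∀ t, 0 ≤ t → t ≤ δ → π t = p * t) (hn : ∀ t, 0 ≤ t → t ≤ δ → π (-t) = -(n * t))
    (hs : HasRightSlopes π p n)
    (h₁ : IsCGF (truncatedAffineLattice b) π₁) (h₂ : IsCGF (truncatedAffineLattice b) π₂)
    (l₁ : LocallyBddBelow π₁) (l₂ : LocallyBddBelow π₂)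
    (hav : ∀ r, π r = (π₁ r + π₂ r) / 2) : π₁ = π := by
  have m₁ := h.of_average h₁ h₂ hav
  have m₂ := h.of_average h₂ h₁ fun r => by rw [hav r, add_comm]
  have hadd {x y : ℝ} (hxy : π (x + y) = π x + π y) : π₁ (x + y) = π₁ x + π₁ y := by
    linarith [m₁.add_le x y, m₂.add_le x y, hav x, hav y, hav (x + y)]
  have hbdd : ∃ C, ∀ t, |t| ≤ δ → |π₁ t| ≤ C := by
    obtain ⟨a₁, ha₁⟩ := l₁ (-δ) δ
    obtain ⟨a₂, ha₂⟩ := l₂ (-δ) δ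
    -- The upper bound for `π₁ = 2 * π - π₂` comes from the lower bound for `π₂`.
    refine ⟨|a₁| + |a₂| + 2 * (|p| + |n|) * δ, fun t ht => ?_⟩
    have hπ : π t ≤ (|p| + |n|) * δ := by
      rcases le_total 0 t with h0 | h0
      · rw [abs_of_nonneg h0] at ht
        rw [hp t h0 ht]
        nlinarith [le_abs_self p, abs_nonneg p, abs_nonneg n]
      · rw [abs_of_nonpos h0] at ht
        have := hn (-t) (by linarith) ht
        rw [neg_neg] at this
        rw [this]
        nlinarith [neg_abs_le n, le_abs_self n, abs_nonneg p, abs_nonneg n]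
    have b₁ := ha₁ ⟨t, abs_le.1 ht, rfl⟩
    have b₂ := ha₂ ⟨t, abs_le.1 ht, rfl⟩
    have := hav t
    have hnn : 0 ≤ (|p| + |n|) * δ := by positivity
    rw [abs_le]
    constructor <;> linarith [neg_abs_le a₁, neg_abs_le a₂, abs_nonneg a₁, abs_nonneg a₂]
  obtain ⟨C, hC⟩ := hbdd
  obtain ⟨p', hp'⟩ : ∃ p', ∀ t, 0 ≤ t → t ≤ δ → π₁ t = p' * t := by
    refine ⟨π₁ δ / δ, eq_mul_of_additive_of_bounded (C := C) hδ (fun s t h0 h1 h2 => ?_)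
      fun t h0 h1 => hC t (by rwa [abs_of_nonneg h0])⟩
    apply hadd
    rw [hp _ (by linarith) h2, hp s h0 (by linarith), hp t h1 (by linarith)]
    ring
  obtain ⟨n', hn'⟩ : ∃ n', ∀ t, 0 ≤ t → t ≤ δ → π₁ (-t) = -(n' * t) := by
    have := eq_mul_of_additive_of_bounded (g := fun t => π₁ (-t)) (C := C) hδ
      (fun s t h0 h1 h2 => ?_) fun t h0 h1 => hC (-t) (by rwa [abs_neg, abs_of_nonneg h0])
    · exact ⟨-(π₁ (-δ) / δ), fun t h0 h1 => by rw [this t h0 h1]; ring⟩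
    · rw [neg_add]
      apply hadd
      rw [← neg_add, hn _ (by linarith) h2, hn s h0 (by linarith), hn t h1 (by linarith)]
      ring
  set A := (p' - n') / (p - n) with hA
  set B := p' - A * p with hB
  have hpn' : p - n ≠ 0 := by linarith
  have ep : p' = A * p + B := by rw [hB]; ring
  have en : n' = A * n + B := by
    have : A * (p - n) = p' - n' := div_mul_cancel₀ _ hpn'
    rw [hB]; linarith
  set f : ℝ → ℝ := fun x => π₁ x - A * π x - B * x with hf
  have hright (x : ℝ) : ∃ η > 0, ∀ t, 0 ≤ t → t ≤ η → f (x + t) = f x := by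
    obtain ⟨η, hη, hx⟩ := hs x
    refine ⟨min η δ, lt_min hη hδ, fun t h0 h1 => ?_⟩
    have hη' := h1.trans (min_le_left _ _)
    have hδ' := h1.trans (min_le_right _ _)
    simp only [hf]
    rcases hx with hx | hx
    · have e := hx t h0 hη'
      rw [hadd (by rw [e, hp t h0 hδ']), e, hp' t h0 hδ', ep]
      ring
    · have e := hx t h0 hη'
      -- On a piece of slope `n` the tight relation is the one stepping back from `x + t` by `-t`.
      have e' : π₁ (x + t + -t) = π₁ (x + t) + π₁ (-t) :=
        hadd (by rw [e, hn t h0 hδ', add_neg_cancel_right]; ring)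
      rw [add_neg_cancel_right, hn' t h0 hδ', en] at e'
      rw [e]
      linarith
  have hsymm (x : ℝ) : f x = 1 - A - B * b - f (b - x) := by
    simp only [hf]
    linear_combination m₁.symm x - A * h.symm x
  -- Symmetry turns constancy to the right of `b - x` into constancy to the left of `x`.
  have hconst := eq_of_forall_locally_const (f := f) fun x => by
    obtain ⟨η₁, hη₁, e₁⟩ := hright x
    obtain ⟨η₂, hη₂, e₂⟩ := hright (b - x)
    refine ⟨min η₁ η₂, lt_min hη₁ hη₂, fun t h0 h1 =>
      ⟨e₁ t h0 (h1.trans (min_le_left _ _)), ?_⟩⟩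
    have := e₂ t h0 (h1.trans (min_le_right _ _))
    rw [hsymm (x - t), hsymm x, ← this]
    congr 2
    ring
  have f0 : f 0 = 0 := by simp [hf, m₁.zero, h.zero]
  have hB0 : B = 0 := by
    have := hconst (-1) 0
    rw [f0] at this
    simpa [hf, m₁.neg_one, h.neg_one] using this
  have hA1 : A = 1 := by
    have e := hsymm 0
    have := hconst (b - 0) 0
    rw [this, f0, hB0] at e
    linarith
  ext x
  have := hconst x 0
  rw [f0] at this
  simp only [hf, hB0, hA1] at this
  linarith

theorem isExtremeCGF_of_hasRightSlopes {b δ p n : ℝ} {π : ℝ → ℝ}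
    (h : IsSymmSubadditive b π) (hδ : 0 < δ) (hpn : n < p)
    (hp : ∀ t, 0 ≤ t → t ≤ δ → π t = p * t) (hn : ∀ t, 0 ≤ t → t ≤ δ → π (-t) = -(n * t))
    (hs : HasRightSlopes π p n) : IsExtremeCGF (truncatedAffineLattice b) π := by
  refine ⟨h.isCGF, ?_⟩
  rintro ⟨π₁, π₂, h₁, h₂, l₁, l₂, hne, hav⟩
  apply hne
  rw [eq_of_average_of_hasRightSlopes h hδ hpn hp hn hs h₁ h₂ l₁ l₂ hav,
    eq_of_average_of_hasRightSlopes h hδ hpn hp hn hs h₂ h₁ l₂ l₁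
      fun r => by rw [hav r, add_comm]]

theorem slopes_eq_pair {δ p n : ℝ} {π : ℝ → ℝ} (hδ : 0 < δ)
    (hp : ∀ t, 0 ≤ t → t ≤ δ → π t = p * t) (hn : ∀ t, 0 ≤ t → t ≤ δ → π (-t) = -(n * t))
    (hs : HasRightSlopes π p n) : slopes π = {p, n} := by
  ext m
  simp only [Set.mem_insert_iff, Set.mem_singleton_iff]
  constructor
  · rintro ⟨x, y, hxy, c, hc⟩
    obtain ⟨η, hη, hx⟩ := hs x
    set t := min η (y - x) with ht
    have ht0 : 0 < t := lt_min hη (by linarith)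
    have ht1 : t ≤ η := min_le_left _ _
    have ht2 : t ≤ y - x := min_le_right _ _
    have e₀ := hc x ⟨le_rfl, hxy.le⟩
    have e₁ := hc (x + t) ⟨by linarith, by linarith⟩
    refine hx.imp (fun hx => ?_) fun hx => ?_ <;>
    · have e₂ := hx t ht0.le ht1
      exact mul_right_cancel₀ ht0.ne' (by linarith)
  · rintro (rfl | rfl)
    · exact ⟨0, δ, hδ, 0, fun x hx => by rw [hp x hx.1 hx.2]; ring⟩
    · refine ⟨-δ, 0, by linarith, 0, fun x hx => ?_⟩
      have := hn (-x) (by linarith [hx.2]) (by linarith [hx.1])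
      rw [neg_neg] at this
      rw [this]; ring

/-! ### Interpolation from the integers -/

/-- Piecewise linear interpolation of a function on the integers. -/
noncomputable def interp (f : ℤ → ℝ) (x : ℝ) : ℝ :=
  (1 - Int.fract x) * f ⌊x⌋ + Int.fract x * f (⌊x⌋ + 1)

theorem interp_of_mem {f : ℤ → ℝ} {x : ℝ} {m : ℤ} (h₀ : m ≤ x) (h₁ : x ≤ m + 1) :
    interp f x = (m + 1 - x) * f m + (x - m) * f (m + 1) := by
  rcases h₁.lt_or_eq with h₁ | h₁
  · have : ⌊x⌋ = m := Int.floor_eq_iff.2 ⟨h₀, h₁⟩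
    rw [interp, Int.fract, this]
    ring
  · have : ⌊x⌋ = m + 1 := by rw [h₁]; simp
    rw [interp, Int.fract, this, h₁]
    push_cast
    ring

theorem interp_intCast (f : ℤ → ℝ) (m : ℤ) : interp f m = f m := by
  rw [interp_of_mem le_rfl (by linarith)]
  ring

/-- The lines `x`, `y`, `x + y ∈ ℤ` cut the plane into triangles on which both sides are affine, so
it suffices to check the vertices. Keeping only vertices near `(x, y)` lets slack survive locally.
-/
theorem interp_add_le {f : ℤ → ℝ} {x y c : ℝ}
    (h : ∀ i j : ℤ, (i = ⌊x⌋ ∨ i = ⌊x⌋ + 1) → (j = ⌊y⌋ ∨ j = ⌊y⌋ + 1) →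
      (i + j = ⌊x + y⌋ ∨ i + j = ⌊x + y⌋ + 1) → f (i + j) + c ≤ f i + f j) :
    interp f (x + y) + c ≤ interp f x + interp f y := by
  have hx := Int.floor_add_fract x
  have hy := Int.floor_add_fract y
  have a0 := Int.fract_nonneg x
  have b0 := Int.fract_nonneg y
  have a1 := Int.fract_lt_one x
  have b1 := Int.fract_lt_one y
  rw [interp.eq_1 f x, interp.eq_1 f y]
  set m := ⌊x⌋
  set n := ⌊y⌋
  set α := Int.fract x
  set β := Int.fract y
  rcases lt_or_ge (α + β) 1 with hlt | hge
  · have hs : ⌊x + y⌋ = m + n := by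
      rw [Int.floor_eq_iff]; push_cast; constructor <;> linarith
    rw [interp_of_mem (m := m + n) (by push_cast; linarith) (by push_cast; linarith)]
    have h₁ := h m n (by simp) (by simp) (by simp [hs])
    have h₂ := h (m + 1) n (by simp) (by simp) (by right; rw [hs]; ring)
    have h₃ := h m (n + 1) (by simp) (by simp) (by right; rw [hs]; ring)
    have e₂ : m + 1 + n = m + n + 1 := by ring
    have e₃ : m + (n + 1) = m + n + 1 := by ring
    rw [e₂] at h₂
    rw [e₃] at h₃
    have k₁ := mul_le_mul_of_nonneg_left h₁ (by linarith : 0 ≤ 1 - α - β)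
    have k₂ := mul_le_mul_of_nonneg_left h₂ a0
    have k₃ := mul_le_mul_of_nonneg_left h₃ b0
    have ex : x + y - (m + n : ℤ) = α + β := by push_cast; linarith
    have ex' : (m + n : ℤ) + 1 - (x + y) = 1 - α - β := by push_cast; linarith
    rw [ex, ex']
    linarith
  · have hs : ⌊x + y⌋ = m + n + 1 := by
      rw [Int.floor_eq_iff]; push_cast; constructor <;> linarith
    rw [interp_of_mem (m := m + n + 1) (by push_cast; linarith) (by push_cast; linarith)]
    have h₁ := h (m + 1) (n + 1) (by simp) (by simp) (by right; rw [hs]; ring)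
    have h₂ := h (m + 1) n (by simp) (by simp) (by left; rw [hs]; ring)
    have h₃ := h m (n + 1) (by simp) (by simp) (by left; rw [hs]; ring)
    have e₁ : m + 1 + (n + 1) = m + n + 1 + 1 := by ring
    have e₂ : m + 1 + n = m + n + 1 := by ring
    have e₃ : m + (n + 1) = m + n + 1 := by ring
    rw [e₁] at h₁
    rw [e₂] at h₂
    rw [e₃] at h₃
    have k₁ := mul_le_mul_of_nonneg_left h₁ (by linarith : 0 ≤ α + β - 1)
    have k₂ := mul_le_mul_of_nonneg_left h₂ (by linarith : 0 ≤ 1 - β)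
    have k₃ := mul_le_mul_of_nonneg_left h₃ (by linarith : 0 ≤ 1 - α)
    have ex : x + y - (m + n + 1 : ℤ) = α + β - 1 := by push_cast; linarith
    have ex' : (m + n + 1 : ℤ) + 1 - (x + y) = 2 - α - β := by push_cast; linarith
    rw [ex, ex']
    linarith

theorem interp_symm {f : ℤ → ℝ} {B : ℤ} (h : ∀ m, f m + f (B - m) = 1) (x : ℝ) :
    interp f x + interp f (B - x) = 1 := by
  have h₀ := Int.floor_le x
  have h₁ := (Int.lt_floor_add_one x).le
  rw [interp_of_mem h₀ h₁, interp_of_mem (m := B - ⌊x⌋ - 1) (by push_cast; linarith)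
    (by push_cast; linarith)]
  have e := h (⌊x⌋ + 1)
  have e₁ : B - (⌊x⌋ + 1) = B - ⌊x⌋ - 1 := by ring
  have e₂ : B - ⌊x⌋ - 1 + 1 = B - ⌊x⌋ := by ring
  rw [e₁] at e
  rw [e₂]
  push_cast
  linear_combination (⌊x⌋ + 1 - x) * h ⌊x⌋ + (x - ⌊x⌋) * e

theorem interp_le_mul {f : ℤ → ℝ} {p : ℝ} {x : ℝ} (hx : 0 ≤ x)
    (h : ∀ n : ℤ, 0 ≤ n → f n ≤ p * n) : interp f x ≤ p * x := by
  have h₀ := Int.floor_le x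
  have h₁ := (Int.lt_floor_add_one x).le
  have hm : 0 ≤ ⌊x⌋ := Int.floor_nonneg.2 hx
  rw [interp_of_mem h₀ h₁]
  have k₁ := mul_le_mul_of_nonneg_left (h _ hm) (by linarith : 0 ≤ ⌊x⌋ + 1 - x)
  have k₂ := mul_le_mul_of_nonneg_left (h (⌊x⌋ + 1) (by linarith)) (by linarith : 0 ≤ x - ⌊x⌋)
  push_cast at k₂
  nlinarith

theorem interp_le_mul_of_nonpos {f : ℤ → ℝ} {p : ℝ} {x : ℝ} (hx : x ≤ 0)
    (h : ∀ n : ℤ, n ≤ 0 → f n ≤ p * n) : interp f x ≤ p * x := by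
  rcases hx.lt_or_eq with hx | rfl
  · have h₀ := Int.floor_le x
    have h₁ := (Int.lt_floor_add_one x).le
    have hm : ⌊x⌋ < 0 := Int.floor_lt.2 (by simpa using hx)
    rw [interp_of_mem h₀ h₁]
    have k₁ := mul_le_mul_of_nonneg_left (h _ hm.le) (by linarith : 0 ≤ ⌊x⌋ + 1 - x)
    have k₂ := mul_le_mul_of_nonneg_left (h (⌊x⌋ + 1) (by linarith)) (by linarith : 0 ≤ x - ⌊x⌋)
    push_cast at k₂
    nlinarith
  · have := h 0 le_rfl
    have e := interp_intCast f 0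
    push_cast at *
    rw [e]; exact this

theorem abs_interp_sub_le {f : ℤ → ℝ} {x a e : ℝ} (h₀ : |f ⌊x⌋ - a| ≤ e)
    (h₁ : |f (⌊x⌋ + 1) - a| ≤ e) : |interp f x - a| ≤ e := by
  rw [abs_le] at *
  have a0 := Int.fract_nonneg x
  have a1 := (Int.fract_lt_one x).le
  rw [interp]
  constructor <;> nlinarith

/-! ### Rounding to slopes 0 and 1 -/

/-- The clamped line of slope one through the centre of the cell `[n * w, (n + 1) * w]`. -/
noncomputable def stairCell (w : ℝ) (ψ : ℝ → ℝ) (n : ℤ) (x : ℝ) : ℝ :=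
  max (ψ (n * w)) (min (ψ ((n + 1 / 2) * w) + (x - (n + 1 / 2) * w)) (ψ ((n + 1) * w)))

/-- An approximation of `ψ` that agrees with `ψ` on the multiples of `w` and has slopes `0`
and `1`. -/
noncomputable def stair (w : ℝ) (ψ : ℝ → ℝ) (x : ℝ) : ℝ := stairCell w ψ ⌊x / w⌋ x

/-- `ψ` is nondecreasing with slopes at most one. -/
def IsUnitSlope (ψ : ℝ → ℝ) : Prop :=
  ∀ x y, x ≤ y → ψ x ≤ ψ y ∧ ψ y ≤ ψ x + (y - x)

section

variable {w : ℝ} {ψ : ℝ → ℝ}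

theorem stairCell_left (hψ : IsUnitSlope ψ) (hw : 0 < w) (n : ℤ) :
    stairCell w ψ n (n * w) = ψ (n * w) := by
  rw [stairCell, max_eq_left]
  have := (hψ (n * w) ((n + 1 / 2) * w) (by linarith)).2
  exact (min_le_left _ _).trans (by linarith)

theorem stairCell_right (hψ : IsUnitSlope ψ) (hw : 0 < w) (n : ℤ) :
    stairCell w ψ n ((n + 1) * w) = ψ ((n + 1) * w) := by
  have h := (hψ ((n + 1 / 2) * w) ((n + 1) * w) (by linarith)).2
  have h' := (hψ (n * w) ((n + 1) * w) (by linarith)).1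
  rw [stairCell, min_eq_right (by linarith), max_eq_right h']

theorem stair_of_mem (hψ : IsUnitSlope ψ) (hw : 0 < w) {n : ℤ} {x : ℝ} (h₀ : n * w ≤ x)
    (h₁ : x ≤ (n + 1) * w) : stair w ψ x = stairCell w ψ n x := by
  rcases h₁.lt_or_eq with h₁ | h₁
  · have : ⌊x / w⌋ = n := by
      rw [Int.floor_eq_iff, le_div_iff₀ hw, div_lt_iff₀ hw]; exact ⟨h₀, h₁⟩
    rw [stair, this]
  · have : ⌊x / w⌋ = n + 1 := by
      rw [Int.floor_eq_iff, le_div_iff₀ hw, div_lt_iff₀ hw]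
      push_cast
      constructor <;> nlinarith
    rw [stair, this, h₁, stairCell_right hψ hw]
    have := stairCell_left hψ hw (n + 1)
    push_cast at this
    exact this

theorem stair_intCast_mul (hψ : IsUnitSlope ψ) (hw : 0 < w) (n : ℤ) :
    stair w ψ (n * w) = ψ (n * w) := by
  rw [stair_of_mem hψ hw le_rfl (by linarith), stairCell_left hψ hw]

theorem floor_cell (hw : 0 < w) (x : ℝ) : ⌊x / w⌋ * w ≤ x ∧ x < (⌊x / w⌋ + 1) * w := by
  rw [← le_div_iff₀ hw, ← div_lt_iff₀ hw]
  exact ⟨Int.floor_le _, Int.lt_floor_add_one _⟩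

theorem stairCell_isUnitSlope (n : ℤ) : IsUnitSlope (stairCell w ψ n) := by
  intro x y hxy
  unfold stairCell
  constructor
  · gcongr
  · rw [max_le_iff]
    constructor
    · linarith [le_max_left (ψ (n * w)) (min (ψ ((n + 1 / 2) * w) + (x - (n + 1 / 2) * w))
        (ψ ((n + 1) * w)))]
    · have h := le_max_right (ψ (n * w)) (min (ψ ((n + 1 / 2) * w) + (x - (n + 1 / 2) * w))
        (ψ ((n + 1) * w)))
      rcases min_choice (ψ ((n + 1 / 2) * w) + (x - (n + 1 / 2) * w)) (ψ ((n + 1) * w))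
        with h' | h' <;> rw [h'] at h ⊢
      · linarith [min_le_left (ψ ((n + 1 / 2) * w) + (y - (n + 1 / 2) * w)) (ψ ((n + 1) * w))]
      · linarith [min_le_right (ψ ((n + 1 / 2) * w) + (y - (n + 1 / 2) * w)) (ψ ((n + 1) * w))]

theorem stair_isUnitSlope (hψ : IsUnitSlope ψ) (hw : 0 < w) : IsUnitSlope (stair w ψ) := by
  intro x y hxy
  obtain ⟨hx₀, hx₁⟩ := floor_cell hw x
  obtain ⟨hy₀, hy₁⟩ := floor_cell hw y
  have hmn : ⌊x / w⌋ ≤ ⌊y / w⌋ := Int.floor_le_floor (by gcongr)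
  rw [stair_of_mem hψ hw hx₀ hx₁.le, stair_of_mem hψ hw hy₀ hy₁.le]
  set m := ⌊x / w⌋
  set n := ⌊y / w⌋
  rcases hmn.lt_or_eq with hmn | hmn
  · have hmn' : (m : ℝ) + 1 ≤ n := by exact_mod_cast hmn
    have h₁ := stairCell_isUnitSlope (w := w) (ψ := ψ) m x ((m + 1) * w) hx₁.le
    have h₂ := stairCell_isUnitSlope (w := w) (ψ := ψ) n (n * w) y hy₀
    have h₃ := hψ ((m + 1) * w) (n * w) (by gcongr)
    rw [stairCell_right hψ hw] at h₁
    rw [stairCell_left hψ hw] at h₂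
    constructor <;> linarith
  · rw [← hmn]
    exact stairCell_isUnitSlope m x y hxy

theorem abs_stair_sub_le (hψ : IsUnitSlope ψ) (hw : 0 < w) (x : ℝ) :
    |stair w ψ x - ψ x| ≤ w := by
  obtain ⟨hx₀, hx₁⟩ := floor_cell hw x
  have h₁ := stair_isUnitSlope hψ hw _ _ hx₀
  have h₂ := hψ _ _ hx₀
  rw [stair_intCast_mul hψ hw] at h₁
  rw [abs_le]
  constructor <;> linarith

/-- As `b` lies on the grid, `x ↦ b - x` maps cells to cells and centres to centres. Anchoring the
sloped line at the centre makes the clamping invariant, the two clamps being exchanged. -/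
theorem stair_symm (hψ : IsUnitSlope ψ) (hw : 0 < w) {B : ℤ} {b K : ℝ} (hb : b = B * w)
    (h : ∀ x, ψ x + ψ (b - x) = K) (x : ℝ) : stair w ψ x + stair w ψ (b - x) = K := by
  obtain ⟨hx₀, hx₁⟩ := floor_cell hw x
  rw [stair_of_mem hψ hw hx₀ hx₁.le, stair_of_mem (n := B - ⌊x / w⌋ - 1) hψ hw
    (by push_cast; linarith) (by push_cast; linarith)]
  set n := ⌊x / w⌋
  have h₁ := h (n * w)
  have h₂ := h ((n + 1 / 2) * w)
  have h₃ := h ((n + 1) * w)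
  have e₁ : b - n * w = ((B - n - 1 : ℤ) + 1) * w := by rw [hb]; push_cast; ring
  have e₂ : b - (n + 1 / 2) * w = ((B - n - 1 : ℤ) + 1 / 2) * w := by rw [hb]; push_cast; ring
  have e₃ : b - (n + 1) * w = (B - n - 1 : ℤ) * w := by rw [hb]; push_cast; ring
  rw [e₁] at h₁
  rw [e₂] at h₂
  rw [e₃] at h₃
  have e₄ : b - x - ((B - n - 1 : ℤ) + 1 / 2) * w = -(x - (n + 1 / 2) * w) := by
    rw [← e₂]; ring
  have hle := (hψ (n * w) ((n + 1) * w) (by linarith)).1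
  unfold stairCell
  rw [e₄]
  generalize ψ (n * w) = p₁ at *
  generalize ψ ((n + 1 / 2) * w) = p₂ at *
  generalize ψ ((n + 1) * w) = p₃ at *
  have f₁ : ψ (((B - n - 1 : ℤ) + 1) * w) = K - p₁ := by linarith
  have f₂ : ψ (((B - n - 1 : ℤ) + 1 / 2) * w) = K - p₂ := by linarith
  have f₃ : ψ ((B - n - 1 : ℤ) * w) = K - p₃ := by linarith
  rw [f₁, f₂, f₃]
  generalize x - (n + 1 / 2) * w = t
  rcases le_total p₁ (p₂ + t) with g₁ | g₁ <;> rcases le_total (p₂ + t) p₃ with g₂ | g₂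
  · rw [min_eq_left g₂, max_eq_right g₁, min_eq_left (by linarith), max_eq_right (by linarith)]
    ring
  · rw [min_eq_right g₂, max_eq_right hle, min_eq_left (by linarith), max_eq_left (by linarith)]
    ring
  · rw [min_eq_left g₂, max_eq_left g₁, min_eq_right (by linarith), max_eq_right (by linarith)]
    ring
  · have : p₁ = p₃ := by linarith
    rw [min_eq_right g₂, max_eq_left (by linarith), min_eq_right (by linarith),
      max_eq_right (by linarith)]
    ring

/-- The breakpoints of `stair w ψ` in the cell `[n * w, (n + 1) * w]`. -/
noncomputable def stairBreak (w : ℝ) (ψ : ℝ → ℝ) (n : ℤ) : Fin 4 → ℝ :=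
  ![n * w, (n + 1 / 2) * w - (ψ ((n + 1 / 2) * w) - ψ (n * w)),
    (n + 1 / 2) * w + (ψ ((n + 1) * w) - ψ ((n + 1 / 2) * w)), (n + 1) * w]

theorem stairBreak_mono (hψ : IsUnitSlope ψ) (hw : 0 < w) (n : ℤ) :
    stairBreak w ψ n 0 ≤ stairBreak w ψ n 1 ∧ stairBreak w ψ n 1 ≤ stairBreak w ψ n 2 ∧
      stairBreak w ψ n 2 ≤ stairBreak w ψ n 3 := by
  have h₁ := hψ (n * w) ((n + 1 / 2) * w) (by linarith)
  have h₂ := hψ ((n + 1 / 2) * w) ((n + 1) * w) (by linarith)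
  simp only [stairBreak, Matrix.cons_val]
  refine ⟨?_, ?_, ?_⟩ <;> linarith

theorem stair_affine (hψ : IsUnitSlope ψ) (hw : 0 < w) (n : ℤ) (i : Fin 3) :
    IsAffineOnWithSlope (stair w ψ)
      (Set.Icc (stairBreak w ψ n i.castSucc) (stairBreak w ψ n i.succ)) (![0, 1, 0] i) := by
  obtain ⟨m₁, m₂, m₃⟩ := stairBreak_mono hψ hw n
  have h₁ := hψ (n * w) ((n + 1) * w) (by linarith)
  simp only [stairBreak, Matrix.cons_val] at m₁ m₂ m₃
  fin_cases i
  · refine ⟨ψ (n * w), fun x hx => ?_⟩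
    simp [stairBreak] at hx ⊢
    rw [stair_of_mem hψ hw (n := n) (by linarith) (by linarith), stairCell, max_eq_left]
    exact (min_le_left _ _).trans (by linarith)
  · refine ⟨ψ ((n + 1 / 2) * w) - (n + 1 / 2) * w, fun x hx => ?_⟩
    simp [stairBreak] at hx ⊢
    rw [stair_of_mem hψ hw (n := n) (by linarith) (by linarith), stairCell, one_div,
      min_eq_left (by linarith), max_eq_right (by linarith)]
    ring
  · refine ⟨ψ ((n + 1) * w), fun x hx => ?_⟩
    simp [stairBreak] at hx ⊢
    rw [stair_of_mem hψ hw (n := n) (by linarith) (by linarith), stairCell, one_div,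
      min_eq_right (by linarith), max_eq_right (by linarith)]

theorem exists_stair_piece (hw : 0 < w) (x : ℝ) :
    ∃ i : Fin 3, stairBreak w ψ ⌊x / w⌋ i.castSucc ≤ x ∧ x < stairBreak w ψ ⌊x / w⌋ i.succ := by
  obtain ⟨hx₀, hx₁⟩ := floor_cell hw x
  rcases lt_or_ge x (stairBreak w ψ ⌊x / w⌋ 1) with h₁ | h₁
  · exact ⟨0, hx₀, h₁⟩
  rcases lt_or_ge x (stairBreak w ψ ⌊x / w⌋ 2) with h₂ | h₂
  · exact ⟨1, h₁, h₂⟩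
  · exact ⟨2, h₂, hx₁⟩

theorem isPiecewiseLinear_stair (hψ : IsUnitSlope ψ) (hw : 0 < w) (s κ : ℝ) :
    IsPiecewiseLinear fun x => s * x + κ * stair w ψ x := by
  let I (k : ℤ × Fin 3) : Set ℝ :=
    Set.Icc (stairBreak w ψ k.1 k.2.castSucc) (stairBreak w ψ k.1 k.2.succ)
  -- Consecutive breakpoints may coincide, so degenerate pieces are discarded.
  refine ⟨{A | A.Nontrivial ∧ ∃ k, A = I k}, ?_, ?_, ?_, ?_⟩
  · rintro _ ⟨hA, k, rfl⟩
    exact ⟨isClosed_Icc, Set.ordConnected_Icc, hA⟩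
  · refine Set.eq_univ_of_forall fun x => ?_
    obtain ⟨i, h₀, h₁⟩ := exists_stair_piece hw x
    refine ⟨I (⌊x / w⌋, i), ⟨?_, _, rfl⟩, h₀, h₁.le⟩
    exact ⟨x, ⟨h₀, h₁.le⟩, _, ⟨h₀.trans h₁.le, le_rfl⟩, h₁.ne⟩
  · intro B hB
    obtain ⟨R, hR⟩ := hB.subset_closedBall 0
    refine (((Set.finite_Icc (⌊-R / w⌋ - 1) ⌈R / w⌉).prod Set.finite_univ).image I).subset ?_
    rintro _ ⟨⟨-, ⟨n, i⟩, rfl⟩, x, hx, hxB⟩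
    refine ⟨(n, i), ⟨?_, trivial⟩, rfl⟩
    have hxR := hR hxB
    rw [Metric.mem_closedBall, dist_zero_right, Real.norm_eq_abs, abs_le] at hxR
    obtain ⟨m₁, m₂, m₃⟩ := stairBreak_mono hψ hw n
    have hx' : stairBreak w ψ n 0 ≤ x ∧ x ≤ stairBreak w ψ n 3 := by
      fin_cases i <;> simp [I] at hx <;> constructor <;> linarith
    obtain ⟨h₀, h₁⟩ := hx'
    simp only [stairBreak, Matrix.cons_val] at h₀ h₁
    constructor
    · have : -R / w ≤ n + 1 := by rw [div_le_iff₀ hw]; linarith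
      have h := Int.floor_le_floor this
      have e : ⌊(n : ℝ) + 1⌋ = n + 1 := by simp
      linarith
    · have : (n : ℝ) ≤ R / w := by rw [le_div_iff₀ hw]; linarith
      exact_mod_cast this.trans (Int.le_ceil _)
  · rintro _ ⟨-, ⟨n, i⟩, rfl⟩
    obtain ⟨c, hc⟩ := stair_affine hψ hw n i
    refine ⟨s + κ * ![0, 1, 0] i, κ * c, fun x hx => ?_⟩
    beta_reduce
    rw [hc x hx]
    ring

theorem hasRightSlopes_stair (hψ : IsUnitSlope ψ) (hw : 0 < w) (s κ : ℝ) :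
    HasRightSlopes (fun x => s * x + κ * stair w ψ x) (s + κ) s := by
  intro x
  obtain ⟨i, h₀, h₁⟩ := exists_stair_piece hw x
  obtain ⟨c, hc⟩ := stair_affine hψ hw ⌊x / w⌋ i
  refine ⟨_, sub_pos.2 h₁, ?_⟩
  have hs : (![0, 1, 0] : Fin 3 → ℝ) i = 1 ∨ (![0, 1, 0] : Fin 3 → ℝ) i = 0 := by
    fin_cases i <;> simp
  refine hs.imp (fun hs t ht₀ ht₁ => ?_) fun hs t ht₀ ht₁ => ?_ <;>
  · beta_reduce
    rw [hc x ⟨h₀, h₁.le⟩, hc (x + t) ⟨by linarith, by linarith⟩, hs]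
    ring

end

/-! ### From slack to an extreme 2-slope function -/

theorem exists_extreme_near {φ : ℝ → ℝ} {b δ γ η p n : ℝ} {B Q : ℤ} (hδ : 0 < δ)
    (hb : b = B * δ) (hQ : 1 = Q * δ) (hpn : n < p) (hγ : 0 < γ) (hη : 0 < η)
    (hsymm : ∀ x, φ x + φ (b - x) = 1)
    (hinc : ∀ x y, x ≤ y → n * (y - x) ≤ φ y - φ x ∧ φ y - φ x ≤ p * (y - x))
    (h₀ : φ 0 = 0) (hφδ : φ δ = p * δ) (hφδ' : φ (-δ) = -(n * δ)) (h₁ : φ (-1) = 0)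
    (hslack : ∀ x y, δ < |x| → δ < |y| → δ < |x + y - b| → φ (x + y) + γ ≤ φ x + φ y) :
    ∃ π : ℝ → ℝ, IsExtremeCGF (truncatedAffineLattice b) π ∧ IsTwoSlope π ∧
      ∀ x, |φ x - π x| ≤ η := by
  set κ := p - n with hκ
  have hκ0 : 0 < κ := sub_pos.2 hpn
  set ψ : ℝ → ℝ := fun x => (φ x - n * x) / κ with hψ
  have hφψ (x : ℝ) : φ x = n * x + κ * ψ x := by
    simp only [hψ]
    rw [mul_div_cancel₀ _ hκ0.ne']
    ring
  have hunit : IsUnitSlope ψ := by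
    intro x y hxy
    obtain ⟨e₁, e₂⟩ := hinc x y hxy
    rw [hφψ x, hφψ y] at e₁ e₂
    constructor
    · refine le_of_mul_le_mul_left ?_ hκ0
      linarith
    · refine le_of_mul_le_mul_left ?_ hκ0
      linarith
  -- Subadditivity involves three values of the function, each perturbed by at most `γ / 3`.
  set e := min η (γ / 3) with he
  have he0 : 0 < e := lt_min hη (by positivity)
  obtain ⟨N, hN⟩ := exists_nat_gt (κ * δ / e)
  have hN0 : (0 : ℝ) < N := lt_of_le_of_lt (by positivity) hN
  set w := δ / N with hw
  have hw0 : 0 < w := by positivity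
  have hNw : N * w = δ := by rw [hw]; field_simp
  have hκw : κ * w ≤ e := by
    rw [div_lt_iff₀ he0] at hN
    rw [hw, ← mul_div_assoc, div_le_iff₀ hN0]
    linarith
  set π : ℝ → ℝ := fun x => n * x + κ * stair w ψ x with hπ
  have hgrid (k : ℤ) : π (k * δ) = φ (k * δ) := by
    have := stair_intCast_mul hunit hw0 (k * N)
    have e : ((k * N : ℤ) : ℝ) * w = k * δ := by push_cast; rw [mul_assoc, hNw]
    rw [e] at this
    simp only [hπ]
    rw [this, hφψ]
  have hclose (x : ℝ) : |φ x - π x| ≤ e := by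
    have h := abs_stair_sub_le hunit hw0 x
    rw [hφψ x]
    simp only [hπ]
    rw [add_sub_add_left_eq_sub, ← mul_sub, abs_mul, abs_of_pos hκ0, abs_sub_comm]
    exact (mul_le_mul_of_nonneg_left h hκ0.le).trans hκw
  have πinc (x y : ℝ) (hxy : x ≤ y) : n * (y - x) ≤ π y - π x ∧ π y - π x ≤ p * (y - x) := by
    obtain ⟨e₁, e₂⟩ := stair_isUnitSlope hunit hw0 x y hxy
    have k₁ := mul_le_mul_of_nonneg_left e₁ hκ0.le
    have k₂ := mul_le_mul_of_nonneg_left e₂ hκ0.le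
    simp only [hπ]
    constructor
    · linarith
    · rw [hκ] at *
      linarith
  have πsymm (x : ℝ) : π x + π (b - x) = 1 := by
    have hb' : b = (B * N : ℤ) * w := by push_cast; rw [mul_assoc, hNw, hb]
    have h := stair_symm (K := (1 - n * b) / κ) hunit hw0 hb' (fun x => by
      simp only [hψ]
      rw [← add_div, ← hsymm x]
      ring) x
    simp only [hπ]
    have : κ * ((1 - n * b) / κ) = 1 - n * b := mul_div_cancel₀ _ hκ0.ne'
    rw [← h] at this
    linarith
  have π0 : π 0 = 0 := by simpa [h₀] using hgrid 0
  have πδ : π δ = p * δ := by simpa [hφδ] using hgrid 1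
  have πδ' : π (-δ) = -(n * δ) := by simpa [hφδ'] using hgrid (-1)
  have π1 : π (-1) = 0 := by
    have h := hgrid (-Q)
    have e : ((-Q : ℤ) : ℝ) * δ = -1 := by push_cast; linarith
    rw [e] at h
    rw [h, h₁]
  have πp (t : ℝ) (ht : 0 ≤ t) (ht' : t ≤ δ) : π t = p * t := by
    have e₁ := (πinc 0 t ht).2
    have e₂ := (πinc t δ ht').2
    rw [π0] at e₁
    rw [πδ] at e₂
    linarith
  have πn (t : ℝ) (ht : 0 ≤ t) (ht' : t ≤ δ) : π (-t) = -(n * t) := by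
    have e₁ := (πinc (-t) 0 (by linarith)).1
    have e₂ := (πinc (-δ) (-t) (by linarith)).1
    rw [π0] at e₁
    rw [πδ'] at e₂
    linarith
  -- Near `0` the function already has its extreme slopes, so no increment elsewhere can exceed `π
  -- x`.
  have near (x y : ℝ) (hx : |x| ≤ δ) : π (x + y) ≤ π x + π y := by
    rw [abs_le] at hx
    rcases le_total 0 x with h | h
    · have e₁ := (πinc y (x + y) (by linarith)).2
      rw [πp x h hx.2]
      linarith
    · have e₁ := (πinc (x + y) y (by linarith)).1
      have e₂ := πn (-x) (by linarith) (by linarith)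
      rw [neg_neg] at e₂
      rw [e₂]
      linarith
  have πadd (x y : ℝ) : π (x + y) ≤ π x + π y := by
    rcases le_or_gt |x| δ with hx | hx
    · exact near x y hx
    rcases le_or_gt |y| δ with hy | hy
    · rw [add_comm x, add_comm (π x)]; exact near y x hy
    rcases le_or_gt |x + y - b| δ with hxy | hxy
    · have e₁ := near (b - (x + y)) x (by rwa [abs_sub_comm])
      have e₂ := πsymm (x + y)
      have e₃ := πsymm y
      have e₄ : b - (x + y) + x = b - y := by ring
      rw [e₄] at e₁
      linarith
    · have k := hslack x y hx hy hxy
      have k₁ := abs_le.1 ((hclose x).trans (min_le_right _ _))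
      have k₂ := abs_le.1 ((hclose y).trans (min_le_right _ _))
      have k₃ := abs_le.1 ((hclose (x + y)).trans (min_le_right _ _))
      linarith
  have hright : HasRightSlopes π p n := by
    have := hasRightSlopes_stair hunit hw0 n κ
    rwa [hκ, add_sub_cancel] at this
  refine ⟨π, ?_, ⟨isPiecewiseLinear_stair hunit hw0 n κ, ?_⟩,
    fun x => (hclose x).trans (min_le_left _ _)⟩
  · exact isExtremeCGF_of_hasRightSlopes ⟨π0, π1, πadd, πsymm⟩ hδ hpn πp πn hright
  · rw [slopes_eq_pair hδ πp πn hright]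
    exact Set.encard_pair hpn.ne'

/-! ### A strictly subadditive symmetric function -/

open Classical in
/-- A function with values in `[0, 1 - b / 2]` that depends only on whether its argument is `0`,
`b`, an integer, or differs from `b` by an integer. -/
noncomputable def residueStep (b u : ℝ) : ℝ :=
  if u = 0 then 0 else if u = b then 1 - b / 2 else
    if ∃ k : ℤ, u = k then 1 / 2 else if ∃ k : ℤ, u = b + k then (1 - b) / 2 else
      (1 - b / 2) / 2

/-- A symmetric subadditive function that is strictly subadditive except where it cannot be. -/
noncomputable def strictSymm (b u : ℝ) : ℝ := u / 2 + residueStep b u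

section

variable {b : ℝ}

theorem residueStep_zero : residueStep b 0 = 0 := by simp [residueStep]

theorem residueStep_self (hb : b < 0) : residueStep b b = 1 - b / 2 := by
  simp [residueStep, hb.ne]

theorem residueStep_of_int {u : ℝ} (hz : ∀ z : ℤ, b ≠ z) (h0 : u ≠ 0) (h : ∃ k : ℤ, u = k) :
    residueStep b u = 1 / 2 := by
  have hub : u ≠ b := by
    rintro rfl
    obtain ⟨k, hk⟩ := h
    exact hz k hk
  rw [residueStep, if_neg h0, if_neg hub, if_pos h]

theorem residueStep_of_add_int {u : ℝ} (hz : ∀ z : ℤ, b ≠ z) (hub : u ≠ b)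
    (h : ∃ k : ℤ, u = b + k) : residueStep b u = (1 - b) / 2 := by
  obtain ⟨k, rfl⟩ := h
  have hi : ¬ ∃ j : ℤ, b + k = j := by
    rintro ⟨j, hj⟩
    exact hz (j - k) (by push_cast; linarith)
  have h0 : b + k ≠ 0 := fun h => hi ⟨0, by simpa using h⟩
  rw [residueStep, if_neg h0, if_neg hub, if_neg hi, if_pos ⟨k, rfl⟩]

theorem residueStep_of_not {u : ℝ} (h₁ : ¬ ∃ k : ℤ, u = k) (h₂ : ¬ ∃ k : ℤ, u = b + k) :
    residueStep b u = (1 - b / 2) / 2 := by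
  have h0 : u ≠ 0 := fun h => h₁ ⟨0, by simpa using h⟩
  have hb : u ≠ b := fun h => h₂ ⟨0, by simpa using h⟩
  rw [residueStep, if_neg h0, if_neg hb, if_neg h₁, if_neg h₂]

theorem residueStep_nonneg (hb : b < 0) (u : ℝ) : 0 ≤ residueStep b u := by
  unfold residueStep
  split_ifs <;> linarith

theorem residueStep_le (hb : b < 0) (u : ℝ) : residueStep b u ≤ 1 - b / 2 := by
  unfold residueStep
  split_ifs <;> linarith

theorem residueStep_le_of_ne (hb : b < 0) {u : ℝ} (hu : u ≠ b) :
    residueStep b u ≤ (1 - b) / 2 := by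
  unfold residueStep
  split_ifs <;> first | contradiction | linarith

theorem le_residueStep_of_not_int (hb : b < 0) {u : ℝ} (hu : ¬ ∃ k : ℤ, u = k) :
    (1 - b / 2) / 2 ≤ residueStep b u := by
  have h0 : u ≠ 0 := fun h => hu ⟨0, by simpa using h⟩
  unfold residueStep
  split_ifs <;> first | contradiction | linarith

theorem residueStep_symm (hb : b < 0) (hz : ∀ z : ℤ, b ≠ z) (u : ℝ) :
    residueStep b u + residueStep b (b - u) = 1 - b / 2 := by
  by_cases h0 : u = 0
  · subst h0
    rw [sub_zero, residueStep_zero, residueStep_self hb, zero_add]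
  by_cases hub : u = b
  · subst hub
    rw [sub_self, residueStep_zero, residueStep_self hb, add_zero]
  by_cases hi : ∃ k : ℤ, u = k
  · rw [residueStep_of_int hz h0 hi]
    obtain ⟨k, rfl⟩ := hi
    rw [residueStep_of_add_int hz (fun h => h0 (by linarith)) ⟨-k, by push_cast; ring⟩]
    ring
  by_cases hbi : ∃ k : ℤ, u = b + k
  · rw [residueStep_of_add_int hz hub hbi]
    obtain ⟨k, rfl⟩ := hbi
    rw [residueStep_of_int hz (fun h => hub (by linarith)) ⟨-k, by push_cast; ring⟩]
    ring
  · rw [residueStep_of_not hi hbi, residueStep_of_not]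
    · ring
    · rintro ⟨k, hk⟩
      exact hbi ⟨-k, by push_cast; linarith⟩
    · rintro ⟨k, hk⟩
      exact hi ⟨-k, by push_cast; linarith⟩

theorem residueStep_add_le_of_int (hb : b < 0) (hz : ∀ z : ℤ, b ≠ z) {x y : ℝ} (hx : x ≠ 0)
    (hy : y ≠ 0) (hxy : x + y ≠ b) (hi : ∃ k : ℤ, x = k) :
    residueStep b (x + y) + 1 / 2 ≤ residueStep b x + residueStep b y := by
  rw [residueStep_of_int hz hx hi]
  obtain ⟨k, rfl⟩ := hi
  by_cases hyi : ∃ k : ℤ, y = k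
  · rw [residueStep_of_int hz hy hyi]
    obtain ⟨j, rfl⟩ := hyi
    by_cases h0 : (k : ℝ) + j = 0
    · rw [h0, residueStep_zero]; norm_num
    · rw [residueStep_of_int hz h0 ⟨k + j, by push_cast; rfl⟩]
  by_cases hyb : ∃ k : ℤ, y = b + k
  · have h : (1 - b) / 2 ≤ residueStep b y := by
      by_cases h : y = b
      · rw [h, residueStep_self hb]; linarith
      · rw [residueStep_of_add_int hz h hyb]
    linarith [residueStep_le_of_ne hb hxy]
  · rw [residueStep_of_not hyi hyb, residueStep_of_not]
    · linarith
    · rintro ⟨j, hj⟩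
      exact hyi ⟨j - k, by push_cast; linarith⟩
    · rintro ⟨j, hj⟩
      exact hyb ⟨j - k, by push_cast; linarith⟩

/-- Two non-integers contribute at least `1 - b / 2`, which is `1 / 2` above the largest value off
`b`. A nonzero integer contributes `1 / 2` itself, and translating by it does not raise the value,
as long as `0` and `b` are avoided. -/
theorem residueStep_add_le (hb : b < 0) (hz : ∀ z : ℤ, b ≠ z) {x y : ℝ} (hx : x ≠ 0)
    (hy : y ≠ 0) (hxy : x + y ≠ b) :
    residueStep b (x + y) + 1 / 2 ≤ residueStep b x + residueStep b y := by
  by_cases hxi : ∃ k : ℤ, x = k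
  · exact residueStep_add_le_of_int hb hz hx hy hxy hxi
  by_cases hyi : ∃ k : ℤ, y = k
  · rw [add_comm x, add_comm (residueStep b x)]
    exact residueStep_add_le_of_int hb hz hy hx (by rwa [add_comm]) hyi
  · linarith [le_residueStep_of_not_int hb hxi, le_residueStep_of_not_int hb hyi,
      residueStep_le_of_ne hb hxy]

theorem strictSymm_add_le (hb : b < 0) (hz : ∀ z : ℤ, b ≠ z) {x y : ℝ} (hx : x ≠ 0)
    (hy : y ≠ 0) (hxy : x + y ≠ b) :
    strictSymm b (x + y) + 1 / 2 ≤ strictSymm b x + strictSymm b y := by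
  unfold strictSymm
  linarith [residueStep_add_le hb hz hx hy hxy]

theorem strictSymm_isSymmSubadditive (hb : b < 0) (hz : ∀ z : ℤ, b ≠ z) :
    IsSymmSubadditive b (strictSymm b) := by
  have h0 : strictSymm b 0 = 0 := by simp [strictSymm, residueStep_zero]
  have hs (x : ℝ) : strictSymm b x + strictSymm b (b - x) = 1 := by
    unfold strictSymm
    linarith [residueStep_symm hb hz x]
  refine ⟨h0, ?_, fun x y => ?_, hs⟩
  · rw [strictSymm, residueStep_of_int hz (by norm_num) ⟨-1, by simp⟩]
    norm_num
  · by_cases hx : x = 0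
    · simp [hx, h0]
    by_cases hy : y = 0
    · simp [hy, h0]
    by_cases hxy : x + y = b
    · have e₁ := hs x
      have e₂ := hs 0
      rw [sub_zero, h0] at e₂
      have : b - x = y := by linarith
      rw [this] at e₁
      rw [hxy]
      linarith
    · linarith [strictSymm_add_le hb hz hx hy hxy]

/-! ### Perturbation, grid interpolation and the approximation theorem -/

theorem IsSymmSubadditive.convexComb {π₁ π₂ : ℝ → ℝ} {t : ℝ} (h₁ : IsSymmSubadditive b π₁)
    (h₂ : IsSymmSubadditive b π₂) (ht : 0 ≤ t) (ht' : t ≤ 1) :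
    IsSymmSubadditive b fun x => (1 - t) * π₁ x + t * π₂ x := by
  refine ⟨by simp [h₁.zero, h₂.zero], by simp [h₁.neg_one, h₂.neg_one], fun x y => ?_,
    fun x => ?_⟩
  · have k₁ := mul_le_mul_of_nonneg_left (h₁.add_le x y) (sub_nonneg.2 ht')
    have k₂ := mul_le_mul_of_nonneg_left (h₂.add_le x y) ht
    linarith
  · linear_combination (1 - t) * h₁.symm x + t * h₂.symm x

theorem ne_of_one_lt_abs_sub {X : ℝ} {i k : ℤ} (hX : 1 < |X - k|)
    (hi : i = ⌊X⌋ ∨ i = ⌊X⌋ + 1) : i ≠ k := by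
  rintro rfl
  have h₀ := Int.floor_le X
  have h₁ := Int.lt_floor_add_one X
  have hle : |X - i| ≤ 1 := by
    rcases hi with hi | hi <;>
    · have hi' : (i : ℝ) = (⌊X⌋ : ℤ) + ((i - ⌊X⌋ : ℤ) : ℝ) := by push_cast; ring
      rw [hi] at hi'
      simp at hi'
      rw [hi, abs_le]
      push_cast
      constructor <;> linarith
  linarith

/-- Interpolating a strictly subadditive function on a grid and rounding the interpolant to a
function with two slopes. -/
theorem exists_extreme_near_interp {Φ : ℝ → ℝ} {γ η δ : ℝ} {B : ℤ} {q : ℕ}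
    (h : IsSymmSubadditive b Φ) (hb0 : b ≠ 0) (hq : 0 < q) (hδ : δ = 1 / q) (hB : b = B * δ)
    (hγ : 0 < γ) (hη : 0 < η)
    (hslack : ∀ x y, x ≠ 0 → y ≠ 0 → x + y ≠ b → Φ (x + y) + γ ≤ Φ x + Φ y) :
    ∃ π : ℝ → ℝ, IsExtremeCGF (truncatedAffineLattice b) π ∧ IsTwoSlope π ∧
      ∀ x, |interp (fun n => Φ (n * δ)) (x * q) - π x| ≤ η := by
  have hq' : (0 : ℝ) < q := by exact_mod_cast hq
  have hδ0 : 0 < δ := by rw [hδ]; positivity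
  have hδq : δ * q = 1 := by rw [hδ]; field_simp
  set f : ℤ → ℝ := fun n => Φ (n * δ) with hf
  have fadd (i j : ℤ) : f (i + j) ≤ f i + f j := by
    have := h.add_le (i * δ) (j * δ)
    rw [← add_mul] at this
    simpa [hf] using this
  have f0 : f 0 = 0 := by simp [hf, h.zero]
  have fpos (k : ℤ) (hk : 0 ≤ k) : f k ≤ f 1 * k := by
    obtain ⟨m, rfl⟩ := Int.eq_ofNat_of_zero_le hk
    have := subadditive_nsmul_le h.zero h.add_le m δ
    simpa [hf, mul_comm] using this
  have fneg (k : ℤ) (hk : k ≤ 0) : f k ≤ -f (-1) * k := by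
    obtain ⟨m, hm⟩ := Int.eq_ofNat_of_zero_le (neg_nonneg.2 hk)
    obtain rfl : k = -m := by omega
    have := subadditive_nsmul_le h.zero h.add_le m (-δ)
    simpa [hf, mul_comm] using this
  have iadd (x y : ℝ) : interp f (x + y) ≤ interp f x + interp f y := by
    have := interp_add_le (f := f) (x := x) (y := y) (c := 0)
      fun i j _ _ _ => by simpa using fadd i j
    simpa using this
  -- Slack at the pair `δ`, `-δ`, whose sum `0` differs from `b`, separates the two slopes.
  have hlt : 0 < f 1 + f (-1) := by
    have := hslack δ (-δ) hδ0.ne' (neg_ne_zero.2 hδ0.ne') (by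
      rw [add_neg_cancel]; exact hb0.symm)
    rw [add_neg_cancel, h.zero] at this
    simp only [hf, Int.cast_one, one_mul, Int.cast_neg, neg_mul]
    linarith
  have hBq : b * q = B := by rw [hB, mul_assoc, hδq, mul_one]
  refine exists_extreme_near (p := f 1 * q) (n := -f (-1) * q) (γ := γ) (Q := q) hδ0 hB
    (by push_cast; linarith) (by nlinarith) hγ hη (fun x => ?_) (fun x y hxy => ⟨?_, ?_⟩) ?_ ?_ ?_
    ?_ (fun x y hx hy hxy => ?_)
  · have e : (b - x) * q = B - x * q := by rw [sub_mul, hBq]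
    rw [e]
    refine interp_symm (fun m => ?_) _
    have e' : b - m * δ = (B - m : ℤ) * δ := by rw [hB]; push_cast; ring
    have := h.symm (m * δ)
    rwa [e'] at this
  · have e₁ := iadd (y * q) ((x - y) * q)
    have e₂ := interp_le_mul_of_nonpos (f := f) (p := -f (-1)) (x := (x - y) * q)
      (mul_nonpos_of_nonpos_of_nonneg (by linarith) hq'.le) fneg
    have e₃ : y * q + (x - y) * q = x * q := by ring
    rw [e₃] at e₁
    linarith
  · have e₁ := iadd (x * q) ((y - x) * q)
    have e₂ := interp_le_mul (f := f) (p := f 1) (x := (y - x) * q)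
      (mul_nonneg (by linarith) hq'.le) fpos
    have e₃ : x * q + (y - x) * q = y * q := by ring
    rw [e₃] at e₁
    linarith
  · have := interp_intCast f 0
    rw [Int.cast_zero] at this
    rw [zero_mul, this, f0]
  · have := interp_intCast f 1
    rw [Int.cast_one] at this
    rw [hδq, this]
    linear_combination (-f 1) * hδq
  · have := interp_intCast f (-1)
    rw [Int.cast_neg, Int.cast_one] at this
    rw [neg_mul, hδq, this]
    linear_combination (-f (-1)) * hδq
  · have := interp_intCast f (-q)
    push_cast at this
    rw [neg_one_mul, this]
    have e : ((-q : ℤ) : ℝ) * δ = -1 := by push_cast; linarith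
    simp only [hf]
    rw [e, h.neg_one]
  · have scale {z : ℝ} (hz : δ < |z|) : 1 < |z * q| := by
      rw [abs_mul, abs_of_pos hq', ← hδq]
      gcongr
    rw [add_mul]
    -- More than one grid step away from the exceptional lines, the neighbouring grid points avoid
    -- them.
    refine interp_add_le fun i j hi hj hij => ?_
    have i0 : i ≠ 0 := ne_of_one_lt_abs_sub (by simpa using scale hx) hi
    have j0 : j ≠ 0 := ne_of_one_lt_abs_sub (by simpa using scale hy) hj
    have ijB : i + j ≠ B := ne_of_one_lt_abs_sub (by
      have := scale hxy
      rwa [sub_mul, hBq, add_mul] at this) hij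
    have := hslack (i * δ) (j * δ) (mul_ne_zero (by exact_mod_cast i0) hδ0.ne')
      (mul_ne_zero (by exact_mod_cast j0) hδ0.ne') (fun he => ijB (by
        rw [← add_mul, hB] at he
        exact_mod_cast mul_right_cancel₀ hδ0.ne' he))
    rw [← add_mul] at this
    simpa [hf] using this

end

/-- Only boundedness of `π₀ - π` is needed, so a discontinuous `π₀` is harmless: its weight `t` is
small, and uniform continuity of `π` controls the rest. The window is widened by `1` to contain the
neighbouring grid points. -/
theorem exists_interp_near {π π₀ : ℝ → ℝ} (hcont : Continuous π) {M C ε : ℝ} (hε : 0 < ε)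
    (hC : ∀ x ∈ Set.Icc (-(M + 1)) (M + 1), |π₀ x - π x| ≤ C) (d : ℕ) (hd : 0 < d) :
    ∃ t : ℝ, 0 < t ∧ t ≤ 1 ∧ ∃ q : ℕ, 0 < q ∧ d ∣ q ∧ ∀ x ∈ Set.Icc (-M) M,
      |interp (fun n => (1 - t) * π (n * (1 / q : ℝ)) + t * π₀ (n * (1 / q : ℝ))) (x * q) - π x|
        ≤ ε := by
  obtain ⟨ρ, hρ, hu⟩ := Metric.uniformContinuousOn_iff.1
    ((isCompact_Icc (a := -(M + 1)) (b := M + 1)).uniformContinuousOn_of_continuous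
      hcont.continuousOn) (ε / 2) (by positivity)
  set t := min 1 (ε / 2 / (|C| + 1)) with ht
  have hC1 : 0 < |C| + 1 := by positivity
  have ht0 : 0 < t := lt_min one_pos (by positivity)
  have htC : t * C ≤ ε / 2 := by
    have h₁ : t * (|C| + 1) ≤ ε / 2 := by
      rw [← le_div_iff₀ hC1]; exact min_le_right _ _
    nlinarith [le_abs_self C]
  obtain ⟨K, hK⟩ := exists_nat_gt (max 1 (1 / ρ))
  have hK1 : (1 : ℝ) < K := (le_max_left _ _).trans_lt hK
  have hKρ : 1 / ρ < K := (le_max_right _ _).trans_lt hK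
  have hK0 : 0 < K := by
    have : (0 : ℝ) < K := by linarith
    exact_mod_cast this
  refine ⟨t, ht0, min_le_left _ _, d * K, by positivity, dvd_mul_right _ _, fun x hx => ?_⟩
  have hdK : (K : ℝ) ≤ (d * K : ℕ) := by exact_mod_cast Nat.le_mul_of_pos_left K hd
  set q := d * K with hq
  have hq0 : (0 : ℝ) < q := by linarith
  set δ := (1 / q : ℝ) with hδ
  have hδ0 : 0 < δ := by positivity
  have hδ1 : δ < 1 := by rw [hδ, div_lt_one hq0]; linarith
  have hδρ : δ < ρ := by
    rw [hδ, div_lt_comm₀ hq0 hρ]; linarith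
  have hδq : q * δ = 1 := by rw [hδ]; field_simp
  have key (n : ℤ) (hn : |n * δ - x| ≤ δ) :
      |(1 - t) * π (n * δ) + t * π₀ (n * δ) - π x| ≤ ε := by
    have hn' := abs_le.1 hn
    have hmem : n * δ ∈ Set.Icc (-(M + 1)) (M + 1) := by
      constructor <;> linarith [hx.1, hx.2]
    have hmem' : x ∈ Set.Icc (-(M + 1)) (M + 1) := by
      constructor <;> linarith [hx.1, hx.2]
    have h₁ := hu _ hmem _ hmem' (by rw [Real.dist_eq]; linarith)
    rw [Real.dist_eq] at h₁
    have h₂ := mul_le_mul_of_nonneg_left (hC _ hmem) ht0.le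
    have e : (1 - t) * π (n * δ) + t * π₀ (n * δ) - π x
        = t * (π₀ (n * δ) - π (n * δ)) + (π (n * δ) - π x) := by ring
    rw [e]
    refine (abs_add_le _ _).trans ?_
    rw [abs_mul, abs_of_pos ht0]
    linarith
  have h₀ := mul_le_mul_of_nonneg_right (Int.floor_le (x * q)) hδ0.le
  have h₁ := mul_le_mul_of_nonneg_right (Int.lt_floor_add_one (x * q)).le hδ0.le
  rw [mul_assoc, hδq] at h₀ h₁
  refine abs_interp_sub_le (key _ ?_) (key _ ?_)
  · rw [abs_le]; constructor <;> linarith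
  · push_cast
    rw [abs_le]; constructor <;> linarith

theorem theorem3 (b : ℚ) (hb_not_int : ∀ z : ℤ, b ≠ (z : ℚ)) (hb : b ≤ 0)
    (πbar : ℝ → ℝ) (hcont : Continuous πbar)
    (hmin : IsStronglyMinimal (truncatedAffineLattice (b : ℝ)) πbar)
    (hquasi : ∃ d : ℚ, IsQuasiPeriodic πbar (d : ℝ))
    (M : ℝ) (hM : 0 ≤ M) (ε : ℝ) (hε : 0 < ε) :
    ∃ πstar : ℝ → ℝ,
      IsExtremeCGF (truncatedAffineLattice (b : ℝ)) πstar ∧ IsTwoSlope πstar ∧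
        ∀ r ∈ Set.Icc (-M) M, |πbar r - πstar r| ≤ ε := by
  have hb' : b < 0 := hb.lt_of_ne fun h => hb_not_int 0 (by simpa using h)
  have hbR : (b : ℝ) < 0 := by exact_mod_cast hb'
  have hz : ∀ z : ℤ, (b : ℝ) ≠ z := fun z h => hb_not_int z (by exact_mod_cast h)
  have hsub := hmin.isSymmSubadditive hb'
  obtain ⟨D, hD⟩ := (isCompact_Icc (a := -(M + 1)) (b := M + 1)).exists_bound_of_continuousOn
    hcont.continuousOn
  have hC : ∀ x ∈ Set.Icc (-(M + 1)) (M + 1),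
      |strictSymm b x - πbar x| ≤ (M + 1) / 2 + (1 - b / 2) + D := by
    intro x hx
    have h₁ := abs_le.1 (hD x hx)
    have h₂ := residueStep_nonneg hbR x
    have h₃ := residueStep_le hbR x
    unfold strictSymm
    rw [abs_le]
    constructor <;> linarith [hx.1, hx.2]
  -- Divisibility of `q` by `b.den` puts `b` on the grid.
  obtain ⟨t, ht0, ht1, q, hq, ⟨m, hm⟩, hnear⟩ :=
    exists_interp_near hcont (half_pos hε) hC b.den b.den_pos
  have hB : (b : ℝ) = (b.num * m : ℤ) * (1 / q : ℝ) := by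
    have hq0 : (q : ℝ) ≠ 0 := by exact_mod_cast hq.ne'
    have h₁ : (b : ℝ) * b.den = b.num := by exact_mod_cast Rat.mul_den_eq_num b
    rw [mul_one_div, eq_div_iff hq0, hm]
    push_cast
    rw [← h₁]; ring
  obtain ⟨π, hext, htwo, hπ⟩ := exists_extreme_near_interp (γ := t / 2)
    (hsub.convexComb (strictSymm_isSymmSubadditive hbR hz) ht0.le ht1) hbR.ne hq rfl hB
    (half_pos ht0) (half_pos hε) (fun x y hx hy hxy => by
      have k₁ := mul_le_mul_of_nonneg_left (hsub.add_le x y) (sub_nonneg.2 ht1)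
      have k₂ := mul_le_mul_of_nonneg_left (strictSymm_add_le hbR hz hx hy hxy) ht0.le
      linarith)
  refine ⟨π, hext, htwo, fun r hr => ?_⟩
  have h₁ := abs_le.1 (hnear r hr)
  have h₂ := abs_le.1 (hπ r)
  rw [abs_le]
  constructor <;> linarith
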